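/- Let $\mathcal S_{d-1}$ be the Euclidean unit sphere of $\mathbb R^d$, $d\ge 1$. For $R>0$ and a set $\mathcal X\subseteq\mathbb R^d$ with $\|x\|\le R$ for all $x\in\mathcal X$, let $\mathcal G$ be the class of all functions $g:\mathcal X\to[0,1]$ of the form $g(x)=h(\alpha^\top x)$ with $\alpha\in\mathcal S_{d-1}$ and $h:[-2R,2R]\to[0,1]$ non-increasing. For a Borel measure $\mu$ put $\|f\|_\mu=\bigl(\int_{\mathcal X}f^2\,d\mu\bigr)^{1/2}$, and let $N_B(\varepsilon,\mathcal G,\|\cdot\|_\mu)$ be the minimal number of $\varepsilon$-brackets needed to cover $\mathcal G$, where an $\varepsilon$-bracket $[l,u]$ is the set of functions $f$ with $l\le f\le u$ on $\mathcal X$, for given functions $l\le u$ on $\mathcal X$ of finite $\|\cdot\|_\mu$-norm with $\|u-l\|_\mu<\varepsilon$. There are universal constants $A,K>0$ such that for all $d\ge1$, $R>0$, $D>0$, all such $\mathcal X$, every probability measure $\mu$ concentrated on $\mathcal X$ (that is, $\mu(\mathcal X^c)=0$) that has a Lebesgue density bounded from above by $D$, and every $\varepsilon>0$, the number $N_B(\varepsilon,\mathcal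 G,\|\cdot\|_\mu)$ is finite and \[ \log N_B(\varepsilon,\mathcal G,\|\cdot\|_\mu)\le\frac{2^{(d+1)/2}\,d^{1/4}\,R^{(d-1)/2}\,(1+\sqrt R)\,(d\sqrt A+K\sqrt R)\,\sqrt D}{\varepsilon}. \] -/

import Mathlib

open MeasureTheory Set
open scoped ENNReal

/-- `[l, u]` is an `ε`-bracket for the `L²(μ)`-norm: `l ≤ u` pointwise, both functions have finite
`L²(μ)`-norm, and `‖u - l‖_μ < ε`. -/
def IsL2Bracket {Ω : Type*} [MeasurableSpace Ω] (μ : Measure Ω) (ε : ℝ) (l u : Ω → ℝ) : Prop :=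
  MemLp l 2 μ ∧ MemLp u 2 μ ∧ (∀ x, l x ≤ u x) ∧
    eLpNorm (fun x => u x - l x) 2 μ < ENNReal.ofReal ε

/-- The finite family `B` of brackets covers the class `T`: every `f ∈ T` lies, pointwise
everywhere, in some bracket of the family. -/
def BracketsCover {Ω : Type*} (B : Finset ((Ω → ℝ) × (Ω → ℝ))) (T : Set (Ω → ℝ)) : Prop :=
  ∀ f ∈ T, ∃ b ∈ B, ∀ x, b.1 x ≤ f x ∧ f x ≤ b.2 x

/-- The bracketing number `N_B(ε, T, ‖·‖_μ)`: the least number of `ε`-brackets covering `T`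
(`⊤` if no finite family does). -/
noncomputable def bracketingNumber {Ω : Type*} [MeasurableSpace Ω] (μ : Measure Ω) (ε : ℝ)
    (T : Set (Ω → ℝ)) : ℕ∞ :=
  sInf {n : ℕ∞ | ∃ B : Finset ((Ω → ℝ) × (Ω → ℝ)),
    (∀ b ∈ B, IsL2Bracket μ ε b.1 b.2) ∧ BracketsCover B T ∧ n = (B.card : ℕ∞)}

/-- The class of non-increasing functions `[-2R, 2R] → [0, 1]` (functions on `ℝ` of which only the
values on `[-2R, 2R]` matter). -/
def monotoneClass (R : ℝ) : Set (ℝ → ℝ) :=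
  {h | AntitoneOn h (Icc (-(2 * R)) (2 * R)) ∧ MapsTo h (Icc (-(2 * R)) (2 * R)) (Icc 0 1)}

/-- The class of functions `x ↦ h(αᵀx)` on `X`, with `α` in the unit sphere of `ℝᵈ` and `h`
non-increasing from `[-2R, 2R]` to `[0, 1]`. -/
def singleIndexClass {d : ℕ} (X : Set (EuclideanSpace ℝ (Fin d))) (R : ℝ) : Set (X → ℝ) :=
  {g | ∃ α ∈ Metric.sphere (0 : EuclideanSpace ℝ (Fin d)) 1, ∃ h ∈ monotoneClass R,
    ∀ x : X, g x = h (inner ℝ α (x : EuclideanSpace ℝ (Fin d)))}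

/-!
The proof encodes every function `x ↦ h (αᵀx)` by a key with finitely many values such that all
functions with the same key lie in a common bracket; the bracketing number is then at most the
number of keys (`bracketingNumber_le_card`).

Let `B = √(D (2R)^d)`, which is at least `1` because `μ` is a probability measure, and fix `J` with
`2 ^ J` of the order of `B / ε` (for `ε > 1` the bracket `[0, 1]` is enough). The direction `α` is
recorded up to an error so small that `αᵀx` moves by at most `w = 4R / 8 ^ J`, which costs `O(d (log
d + J))` in the logarithm. It remains to bracket the non-increasing sequence `F` of values of `h` on
a grid of step `w`. A single resolution is not enough: with a step `2 ^ (-J)` the brackets are of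
width one near the jumps of `h` and have `L²`-norm `2 ^ (-J / 2)` only, and with a finer step the
number of keys is too large. Instead `F` is recorded at all levels `k = 1, …, J` at once: on the
coarser grid of step `4 ^ k * w`, its values are rounded down to multiples of `2 ^ (-k)`.

* *Width of the brackets.* The rounded sequence of level `k` takes at most `2 ^ k + 1` values, so it
  jumps near at most `3 * 2 ^ k` of its cells (`card_jumps_le`). Away from those cells the level `k`
  determines `F` up to `2 ^ (-k)`. The set of `x` for which `αᵀx` lies in a given cell is a slab, of
  mass at most `D (2R)^(d-1) * 4 ^ k * w` (`volume_closedBall_inter_slab_le`). On the cells where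
  level `k` jumps but level `k - 1` does not, the squared `L²`-width is therefore `O(4 ^ (-k) * 2 ^
  k * 4 ^ k * w * D (2R)^(d-1)) = O(2 ^ k * B ^ 2 / 8 ^ J)`, and the sum over the levels is `O(B ^ 2
  / 4 ^ J)`, that is, `O(ε ^ 2)` (`sq_envelope_gap_le`, `eLpNorm_envelope_gap_lt`).
* *Number of keys.* A non-increasing sequence is determined by the multiset of its values, and there
  are `exp O(2 ^ k * (1 + J - k))` multisets of `8 ^ J / 4 ^ k` elements out of `2 ^ k + 1`. The
  product over the levels is `exp O(2 ^ J)` (`card_levels_le_exp`).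

Altogether the logarithm of the number of keys is `O(d ^ (5/4) * 2 ^ J) = O(d ^ (5/4) * B / ε)`, the
factor `d ^ (1/4)` absorbing `log d` (`log_card_le`).
-/

/-! ### Multiscale quantization of a monotone sequence -/

/-- The values of `F` on the grid `4 ^ k * ℕ`, rounded down to multiples of `2 ^ (-k)` (and
stored as integers). -/
noncomputable def quantize (F : ℕ → ℝ) (k q : ℕ) : ℕ := ⌊2 ^ k * F (4 ^ k * q)⌋₊

/-- The best lower bound for `F (Q + 2)` that can be read off from the quantizations `c` of `F` at
the levels `1, …, k`. -/
noncomputable def lowerEnvelope (c : ℕ → ℕ → ℕ) : ℕ → ℕ → ℝ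
  | 0, _ => 0
  | k + 1, Q => max (lowerEnvelope c k Q) (c (k + 1) (Q / 4 ^ (k + 1) + 2) / 2 ^ (k + 1))

/-- The best upper bound for `F (Q - 1)` that can be read off from the quantizations `c` of `F` at
the levels `1, …, k`. The subtractions truncate at `0`, so that near the left end of the grid the
bound is for `F 0`. -/
noncomputable def upperEnvelope (c : ℕ → ℕ → ℕ) : ℕ → ℕ → ℝ
  | 0, _ => 1
  | k + 1, Q => min (upperEnvelope c k Q) ((c (k + 1) (Q / 4 ^ (k + 1) - 1) + 1) / 2 ^ (k + 1))

lemma quantize_antitone {F : ℕ → ℝ} (hF : Antitone F) (k : ℕ) : Antitone (quantize F k) := by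
  intro a b hab
  apply Nat.floor_le_floor
  have : F (4 ^ k * b) ≤ F (4 ^ k * a) := hF (Nat.mul_le_mul_left _ hab)
  gcongr

lemma quantize_le {F : ℕ → ℝ} (hF : ∀ q, F q ≤ 1) (k q : ℕ) : quantize F k q ≤ 2 ^ k := by
  apply Nat.floor_le_of_le
  push_cast
  have := hF (4 ^ k * q)
  have h2 : (0 : ℝ) < 2 ^ k := by positivity
  nlinarith

lemma quantize_div_le {F : ℕ → ℝ} (hF : ∀ q, 0 ≤ F q) (k q : ℕ) :
    (quantize F k q : ℝ) / 2 ^ k ≤ F (4 ^ k * q) := by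
  rw [div_le_iff₀' (by positivity)]
  exact Nat.floor_le (mul_nonneg (by positivity) (hF _))

lemma le_quantize_add_one_div (F : ℕ → ℝ) (k q : ℕ) :
    F (4 ^ k * q) ≤ ((quantize F k q : ℝ) + 1) / 2 ^ k := by
  rw [le_div_iff₀' (by positivity)]
  exact (Nat.lt_floor_add_one _).le

lemma lowerEnvelope_le {F : ℕ → ℝ} (hF : Antitone F) (h0 : ∀ q, 0 ≤ F q) (k Q : ℕ) :
    lowerEnvelope (quantize F) k Q ≤ F (Q + 2) := by
  induction k with
  | zero => exact h0 _
  | succ k ih =>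
    refine max_le ih ((quantize_div_le h0 _ _).trans (hF ?_))
    have h1 := Nat.lt_mul_div_succ Q (show 0 < 4 ^ (k + 1) by positivity)
    have h2 : 1 ≤ 4 ^ (k + 1) := Nat.one_le_pow _ _ (by norm_num)
    nlinarith

lemma le_upperEnvelope {F : ℕ → ℝ} (hF : Antitone F) (h1 : ∀ q, F q ≤ 1) (k Q : ℕ) :
    F (Q - 1) ≤ upperEnvelope (quantize F) k Q := by
  induction k with
  | zero => exact h1 _
  | succ k ih =>
    refine le_min ih ((hF ?_).trans (le_quantize_add_one_div F _ _))
    have h1 := Nat.mul_div_le Q (4 ^ (k + 1))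
    have h2 : 1 ≤ 4 ^ (k + 1) := Nat.one_le_pow _ _ (by norm_num)
    rw [Nat.mul_sub, mul_one]
    omega

lemma lowerEnvelope_nonneg (c : ℕ → ℕ → ℕ) (k Q : ℕ) : 0 ≤ lowerEnvelope c k Q := by
  induction k with
  | zero => exact le_rfl
  | succ k ih => exact ih.trans (le_max_left _ _)

lemma upperEnvelope_le_one (c : ℕ → ℕ → ℕ) (k Q : ℕ) : upperEnvelope c k Q ≤ 1 := by
  induction k with
  | zero => exact le_rfl
  | succ k ih => exact (min_le_left _ _).trans ih

lemma envelope_congr {c c' : ℕ → ℕ → ℕ} {k Q : ℕ}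
    (h : ∀ j < k, ∀ q ≤ Q / 4 ^ (j + 1) + 2, c (j + 1) q = c' (j + 1) q) :
    lowerEnvelope c k Q = lowerEnvelope c' k Q ∧ upperEnvelope c k Q = upperEnvelope c' k Q := by
  induction k with
  | zero => exact ⟨rfl, rfl⟩
  | succ k ih =>
    obtain ⟨hl, hu⟩ := ih fun j hj => h j (hj.trans k.lt_succ_self)
    simp only [lowerEnvelope, upperEnvelope]
    rw [hl, hu, h k k.lt_succ_self _ le_rfl,
      h k k.lt_succ_self _ ((Nat.sub_le _ _).trans (Nat.le_add_right _ _))]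
    exact ⟨rfl, rfl⟩

/-- Let `k ≤ J` be the largest level at which the quantized sequence does not jump near `Q`, or `0`
if there is none. The gap between the envelopes at `Q` is at most `2 ^ (-k)`. If `k = J`, its square
is the first term on the right; otherwise there is a jump at level `k + 1`, and the square is the
`k`-th term of the sum. -/
lemma sq_envelope_gap_le {c : ℕ → ℕ → ℕ} {Q : ℕ}
    (h : ∀ k, lowerEnvelope c k Q ≤ upperEnvelope c k Q) (J : ℕ) :
    (upperEnvelope c J Q - lowerEnvelope c J Q) ^ 2 ≤ (1 / 4) ^ J + ∑ k ∈ Finset.range J,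
      (1 / 4) ^ k * {Q : ℕ | c (k + 1) (Q / 4 ^ (k + 1) - 1) ≠
        c (k + 1) (Q / 4 ^ (k + 1) + 2)}.indicator (1 : ℕ → ℝ) Q := by
  induction J with
  | zero => simp [lowerEnvelope, upperEnvelope]
  | succ J ih =>
    rw [Finset.sum_range_succ]
    have hJ := h (J + 1)
    by_cases hb : c (J + 1) (Q / 4 ^ (J + 1) - 1) = c (J + 1) (Q / 4 ^ (J + 1) + 2)
    · have hs : 0 ≤ ∑ k ∈ Finset.range J, (1 / 4 : ℝ) ^ k * {Q : ℕ |
          c (k + 1) (Q / 4 ^ (k + 1) - 1) ≠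
            c (k + 1) (Q / 4 ^ (k + 1) + 2)}.indicator (1 : ℕ → ℝ) Q :=
        Finset.sum_nonneg fun k _ => mul_nonneg (by positivity)
          (indicator_nonneg (fun _ _ => zero_le_one) _)
      rw [indicator_of_notMem (by simpa using hb)]
      have hgap : upperEnvelope c (J + 1) Q - lowerEnvelope c (J + 1) Q ≤ 1 / 2 ^ (J + 1) := by
        have h1 : upperEnvelope c (J + 1) Q ≤ _ := min_le_right _ _
        have h2 : _ ≤ lowerEnvelope c (J + 1) Q := le_max_right _ _
        rw [hb, add_div] at h1
        linarith
      have : (upperEnvelope c (J + 1) Q - lowerEnvelope c (J + 1) Q) ^ 2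
          ≤ (1 / 2 ^ (J + 1)) ^ 2 := pow_le_pow_left₀ (by linarith) hgap 2
      have h4 : ((1 : ℝ) / 2 ^ (J + 1)) ^ 2 = (1 / 4) ^ (J + 1) := by
        rw [← one_div_pow, ← pow_mul, mul_comm, pow_mul]; norm_num
      linarith
    · rw [indicator_of_mem (by simpa using hb)]
      have h1 : upperEnvelope c (J + 1) Q ≤ upperEnvelope c J Q := min_le_left _ _
      have h2 : lowerEnvelope c J Q ≤ lowerEnvelope c (J + 1) Q := le_max_left _ _
      have : (upperEnvelope c (J + 1) Q - lowerEnvelope c (J + 1) Q) ^ 2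
          ≤ (upperEnvelope c J Q - lowerEnvelope c J Q) ^ 2 :=
        pow_le_pow_left₀ (by linarith) (by linarith) 2
      have h4 : (0 : ℝ) ≤ (1 / 4) ^ (J + 1) := by positivity
      simp only [Pi.one_apply, mul_one]
      linarith

/-- A non-increasing sequence of natural numbers differs between `q - 1` and `q + 2` for at most
`3 * c 0` indices `q`. -/
lemma card_jumps_le {c : ℕ → ℕ} (hc : Antitone c) (M : ℕ) :
    ((Finset.range M).filter fun q => c (q - 1) ≠ c (q + 2)).card ≤ 3 * c 0 := by
  -- The sum of `c (q - 1) - c (q + 2)` over `q < M` telescopes; the second summand is what is left.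
  have key : ∀ M, ((Finset.range M).filter fun q => c (q - 1) ≠ c (q + 2)).card
      + (c (M - 1) + c M + c (M + 1)) ≤ 3 * c 0 := by
    intro M
    induction M with
    | zero =>
      have := hc (Nat.zero_le 1)
      simp
      omega
    | succ M ih =>
      rw [Finset.range_add_one, Finset.filter_insert]
      have h1 : c (M + 2) ≤ c (M - 1) := hc (by omega)
      split_ifs with h
      · rw [Finset.card_insert_of_notMem (by simp)]
        simp only [Nat.add_sub_cancel]
        have : c (M + 1 + 1) = c (M + 2) := rfl
        omega
      · simp only [Nat.add_sub_cancel]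
        have : c (M + 1 + 1) = c (M + 2) := rfl
        omega
  exact (Nat.le_add_right _ _).trans (key M)

/-! ### Counting quantized sequences -/

/-- The multiset of the first `N` values of a sequence with values in `{0, …, m}`. -/
def valueMultiset (m N : ℕ) (c : ℕ → ℕ) : Sym (Fin (m + 1)) N :=
  ⟨((List.range N).map fun q => Fin.ofNat (m + 1) (c q) : List (Fin (m + 1))), by simp⟩

/-- A non-increasing sequence is determined by the multiset of its values. -/
lemma eq_of_valueMultiset_eq {m N : ℕ} {c c' : ℕ → ℕ} (hc : Antitone c) (hc' : Antitone c')
    (hm : ∀ q, c q ≤ m) (hm' : ∀ q, c' q ≤ m) (h : valueMultiset m N c = valueMultiset m N c')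
    {q : ℕ} (hq : q < N) : c q = c' q := by
  have h1 := Multiset.coe_eq_coe.1 (congrArg Subtype.val h)
  have hval : ∀ a : ℕ → ℕ, (∀ q, a q ≤ m) →
      ((List.range N).map fun q => Fin.ofNat (m + 1) (a q)).map Fin.val = (List.range N).map a := by
    intro a ha
    rw [List.map_map]
    refine List.map_congr_left fun q _ => ?_
    simp [Nat.mod_eq_of_lt (Nat.lt_succ_of_le (ha q))]
  have h2 := h1.map Fin.val
  rw [hval c hm, hval c' hm'] at h2
  have hs : ∀ a : ℕ → ℕ, Antitone a → ((List.range N).map a).SortedGE := by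
    intro a ha
    rw [List.sortedGE_iff_pairwise, List.pairwise_map]
    exact List.pairwise_lt_range.imp fun hab => ha hab.le
  have h3 := h2.eq_of_sortedGE (hs c hc) (hs c' hc')
  exact List.map_inj_left.1 h3 q (List.mem_range.2 hq)

lemma card_sym_le_exp {m : ℕ} (hm : 0 < m) (N : ℕ) :
    (Fintype.card (Sym (Fin (m + 1)) N) : ℝ) ≤
      Real.exp (m * (1 + Real.log ((m + N : ℕ) / m))) := by
  have hm' : (0 : ℝ) < m := by exact_mod_cast hm
  rw [Sym.card_sym_eq_choose, Fintype.card_fin, show m + 1 + N - 1 = m + N by omega,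
    Nat.choose_symm_add.symm]
  refine (Nat.choose_le_pow_div m (m + N)).trans ?_
  have h1 : (m : ℝ) ^ m / (m.factorial : ℝ) ≤ Real.exp m :=
    Real.pow_div_factorial_le_exp _ hm'.le m
  have h2 : Real.exp (m * (1 + Real.log ((m + N : ℕ) / m)))
      = Real.exp m * (((m + N : ℕ) : ℝ) / m) ^ m := by
    rw [mul_add, mul_one, Real.exp_add, Real.exp_nat_mul (Real.log _), Real.exp_log]
    have : (0 : ℝ) < (m + N : ℕ) := by exact_mod_cast (by omega : 0 < m + N)
    positivity
  rw [h2]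
  calc (((m + N : ℕ) : ℝ) ^ m) / (m.factorial : ℝ)
      = (m : ℝ) ^ m / (m.factorial : ℝ) * (((m + N : ℕ) : ℝ) / m) ^ m := by
        rw [div_pow]; field_simp
    _ ≤ _ := by gcongr

/-- At level `k + 1` there are `8 ^ (J - k - 1)` times as many grid points as values, and a factor
`8 ^ j` costs only `O(1 + j)` per value. -/
lemma card_level_le_exp (k j : ℕ) :
    (Fintype.card (Sym (Fin (2 ^ (k + 1) + 1)) (8 ^ (k + 1 + j) / 4 ^ (k + 1) + 3)) : ℝ) ≤
      Real.exp (3 * (2 ^ (k + 1) * (j + 1))) := by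
  refine (card_sym_le_exp (by positivity) _).trans (Real.exp_le_exp.2 ?_)
  push_cast
  have hdiv : (8 ^ (k + 1 + j) / 4 ^ (k + 1) : ℕ) = 2 ^ (k + 1) * 8 ^ j := by
    rw [pow_add, show (8 : ℕ) = 4 * 2 by norm_num, mul_pow, mul_assoc,
      Nat.mul_div_cancel_left _ (by positivity)]
  rw [hdiv]
  push_cast
  have h8 : (1 : ℝ) ≤ 8 ^ j := one_le_pow₀ (by norm_num)
  have h2 : (1 : ℝ) ≤ 2 ^ (k + 1) := one_le_pow₀ (by norm_num)
  have hle : ((2 : ℝ) ^ (k + 1) + (2 ^ (k + 1) * 8 ^ j + 3)) / 2 ^ (k + 1) ≤ 5 * 8 ^ j := by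
    rw [div_le_iff₀ (by positivity)]
    nlinarith
  have hlog : Real.log ((2 ^ (k + 1) + (2 ^ (k + 1) * 8 ^ j + 3)) / 2 ^ (k + 1))
      ≤ 2 + 3 * j := by
    refine (Real.log_le_log (by positivity) hle).trans ?_
    rw [Real.log_mul (by norm_num) (by positivity), Real.log_pow]
    have h5 : Real.log 5 ≤ 2 := by
      rw [Real.log_le_iff_le_exp (by norm_num)]
      have := Real.exp_one_gt_d9
      rw [show (2 : ℝ) = 1 + 1 by norm_num, Real.exp_add]
      nlinarith
    have h8' : Real.log 8 ≤ 3 := by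
      rw [show (8 : ℝ) = 2 ^ 3 by norm_num, Real.log_pow]
      have := Real.log_two_lt_d9
      norm_num
      linarith
    have : (0 : ℝ) ≤ j := Nat.cast_nonneg j
    nlinarith
  have hp : (0 : ℝ) < 2 ^ (k + 1) := by positivity
  nlinarith

lemma sum_two_pow_mul_le (J : ℕ) :
    ∑ k ∈ Finset.range J, (2 : ℝ) ^ (k + 1) * ((J - (k + 1) : ℕ) + 1) ≤ 4 * 2 ^ J := by
  have hgeom : ∀ J : ℕ, ∑ k ∈ Finset.range J, (2 : ℝ) ^ (k + 1) ≤ 2 * 2 ^ J := by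
    intro J
    induction J with
    | zero => simp
    | succ J ih => rw [Finset.sum_range_succ, pow_succ]; linarith
  induction J with
  | zero => simp
  | succ J ih =>
    have : ∑ k ∈ Finset.range J, (2 : ℝ) ^ (k + 1) * ((J + 1 - (k + 1) : ℕ) + 1)
        = ∑ k ∈ Finset.range J, (2 : ℝ) ^ (k + 1) * ((J - (k + 1) : ℕ) + 1)
          + ∑ k ∈ Finset.range J, (2 : ℝ) ^ (k + 1) := by
      rw [← Finset.sum_add_distrib]
      refine Finset.sum_congr rfl fun k hk => ?_
      have hk' := Finset.mem_range.1 hk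
      rw [show J + 1 - (k + 1) = J - (k + 1) + 1 by omega]
      push_cast
      ring
    rw [Finset.sum_range_succ, this]
    have := hgeom J
    simp
    rw [pow_succ]
    linarith

/-- The number of codes recording all quantized values at the levels `1, …, J` is `exp O(2 ^ J)`. -/
lemma card_levels_le_exp (J : ℕ) :
    (Fintype.card ((k : Fin J) →
      Sym (Fin (2 ^ ((k : ℕ) + 1) + 1)) (8 ^ J / 4 ^ ((k : ℕ) + 1) + 3)) : ℝ) ≤
      Real.exp (12 * 2 ^ J) := by
  rw [Fintype.card_pi]
  push_cast
  rw [Fin.prod_univ_eq_prod_range (fun k => (Fintype.card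
    (Sym (Fin (2 ^ (k + 1) + 1)) (8 ^ J / 4 ^ (k + 1) + 3)) : ℝ)) J]
  calc _ ≤ ∏ k ∈ Finset.range J, Real.exp (3 * (2 ^ (k + 1) * ((J - (k + 1) : ℕ) + 1))) := by
        refine Finset.prod_le_prod (fun _ _ => Nat.cast_nonneg _) fun k hk => ?_
        have hk' := Finset.mem_range.1 hk
        have := card_level_le_exp k (J - (k + 1))
        rwa [show k + 1 + (J - (k + 1)) = J by omega] at this
    _ = Real.exp (3 * ∑ k ∈ Finset.range J, (2 : ℝ) ^ (k + 1) * ((J - (k + 1) : ℕ) + 1)) := by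
        rw [← Real.exp_sum, Finset.mul_sum]
    _ ≤ _ := by
        refine Real.exp_le_exp.2 ?_
        have := sum_two_pow_mul_le J
        linarith

/-! ### The `L²`-size of the envelope gap -/

lemma eLpNorm_two_lt_of_lintegral_sq_lt {Ω : Type*} [MeasurableSpace Ω] {ν : Measure Ω}
    {f : Ω → ℝ} {ε : ℝ} (hε : 0 < ε)
    (h : ∫⁻ x, ENNReal.ofReal (f x ^ 2) ∂ν < ENNReal.ofReal (ε ^ 2)) :
    eLpNorm f 2 ν < ENNReal.ofReal ε := by
  rw [eLpNorm_eq_lintegral_rpow_enorm_toReal (by norm_num) (by norm_num)]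
  have h1 : ∀ x, ‖f x‖ₑ ^ (2 : ℝ≥0∞).toReal = ENNReal.ofReal (f x ^ 2) := by
    intro x
    rw [ENNReal.toReal_ofNat, ENNReal.rpow_ofNat, ← sq_abs,
      ENNReal.ofReal_pow (abs_nonneg _), Real.enorm_eq_ofReal_abs]
  simp_rw [h1]
  rw [one_div, ENNReal.rpow_inv_lt_iff (by norm_num), ENNReal.toReal_ofNat, ENNReal.rpow_ofNat,
    ← ENNReal.ofReal_pow hε.le]
  exact h

/-- The cells of level `k` near which a non-increasing sequence of naturals jumps have total mass at
most `3 * c 0` times the largest mass of a cell. -/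
lemma measure_jumps_le {Ω : Type*} [MeasurableSpace Ω] {ν : Measure Ω} {Q : Ω → ℕ} {M : ℕ}
    (hM : ∀ x, Q x < M) {c : ℕ → ℕ} (hc : Antitone c) {k : ℕ} {δ : ℝ≥0∞}
    (hν : ∀ q, ν {x | Q x / 4 ^ k = q} ≤ δ) :
    ν {x | c (Q x / 4 ^ k - 1) ≠ c (Q x / 4 ^ k + 2)} ≤ (3 * c 0 : ℕ) * δ := by
  calc ν {x | c (Q x / 4 ^ k - 1) ≠ c (Q x / 4 ^ k + 2)}
      ≤ ν (⋃ q ∈ (Finset.range M).filter fun q => c (q - 1) ≠ c (q + 2),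
          {x | Q x / 4 ^ k = q}) := by
        refine measure_mono fun x hx => ?_
        simp only [mem_iUnion]
        exact ⟨Q x / 4 ^ k, Finset.mem_filter.2
          ⟨Finset.mem_range.2 ((Nat.div_le_self _ _).trans_lt (hM x)), hx⟩, rfl⟩
    _ ≤ ∑ q ∈ (Finset.range M).filter fun q => c (q - 1) ≠ c (q + 2), ν {x | Q x / 4 ^ k = q} :=
        measure_biUnion_finset_le _ _
    _ ≤ ∑ q ∈ (Finset.range M).filter fun q => c (q - 1) ≠ c (q + 2), δ :=
        Finset.sum_le_sum fun q _ => hν q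
    _ ≤ (3 * c 0 : ℕ) * δ := by
        rw [Finset.sum_const, nsmul_eq_mul]
        gcongr
        exact card_jumps_le hc M

/-- With cells of level `k` of mass at most `4 ^ k * κ`, the jumps of level `k` contribute
`4 * 4 ^ (-k) * (3 * 2 ^ k) * (4 ^ k * κ)` to the squared norm, a geometric sum of order
`2 ^ J * κ`. -/
lemma eLpNorm_envelope_gap_lt {Ω : Type*} [MeasurableSpace Ω] {ν : Measure Ω} {Q : Ω → ℕ}
    (hQ : Measurable Q) {M : ℕ} (hM : ∀ x, Q x < M) {c : ℕ → ℕ → ℕ} (hc : ∀ k, Antitone (c k))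
    (hc0 : ∀ k, c k 0 ≤ 2 ^ k) (h : ∀ k Q, lowerEnvelope c k Q ≤ upperEnvelope c k Q) {κ : ℝ}
    (hκ : 0 ≤ κ) (hν : ∀ k q, ν {x | Q x / 4 ^ k = q} ≤ ENNReal.ofReal (4 ^ k * κ)) {J : ℕ}
    (huniv : ν univ ≤ ENNReal.ofReal (8 ^ J * κ)) {ε : ℝ} (hε : 0 < ε)
    (hJ : 25 * 2 ^ J * κ < ε ^ 2) :
    eLpNorm (fun x => upperEnvelope c J (Q x) - lowerEnvelope c J (Q x)) 2 ν
      < ENNReal.ofReal ε := by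
  refine eLpNorm_two_lt_of_lintegral_sq_lt hε ?_
  set bad : ℕ → Set Ω := fun k =>
    {x | c (k + 1) (Q x / 4 ^ (k + 1) - 1) ≠ c (k + 1) (Q x / 4 ^ (k + 1) + 2)} with hbad
  have hbadm : ∀ k, MeasurableSet (bad k) := fun k =>
    hQ (MeasurableSet.of_discrete (s := {n : ℕ | c (k + 1) (n / 4 ^ (k + 1) - 1) ≠
      c (k + 1) (n / 4 ^ (k + 1) + 2)}))
  have hbadν : ∀ k, ν (bad k) ≤ ENNReal.ofReal (3 * 2 ^ (k + 1) * (4 ^ (k + 1) * κ)) := by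
    intro k
    refine (measure_jumps_le hM (hc (k + 1)) (hν (k + 1))).trans ?_
    rw [ENNReal.ofReal_mul (p := 3 * 2 ^ (k + 1)) (by positivity)]
    gcongr
    rw [← ENNReal.ofReal_natCast]
    apply ENNReal.ofReal_le_ofReal
    exact_mod_cast Nat.mul_le_mul_left 3 (hc0 (k + 1))
  calc ∫⁻ x, ENNReal.ofReal ((upperEnvelope c J (Q x) - lowerEnvelope c J (Q x)) ^ 2) ∂ν
      ≤ ∫⁻ x, (ENNReal.ofReal ((1 / 4) ^ J) + ∑ k ∈ Finset.range J,
          ENNReal.ofReal ((1 / 4) ^ k) * (bad k).indicator 1 x) ∂ν := by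
        refine lintegral_mono fun x => ?_
        refine (ENNReal.ofReal_le_ofReal (sq_envelope_gap_le (fun k => h k (Q x)) J)).trans ?_
        have h0 : ∀ k (s : Set ℕ), 0 ≤ (1 / 4 : ℝ) ^ k * s.indicator (1 : ℕ → ℝ) (Q x) :=
          fun k s => mul_nonneg (by positivity) (indicator_nonneg (fun _ _ => zero_le_one) _)
        rw [ENNReal.ofReal_add (by positivity) (Finset.sum_nonneg fun k _ => h0 k _),
          ENNReal.ofReal_sum_of_nonneg (fun k _ => h0 k _)]
        refine add_le_add le_rfl (Finset.sum_le_sum fun k _ => ?_)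
        rw [ENNReal.ofReal_mul (by positivity)]
        refine mul_le_mul_right ?_ _
        by_cases hx : x ∈ bad k
        · rw [indicator_of_mem hx, indicator_of_mem (by exact hx)]; simp
        · rw [indicator_of_notMem hx, indicator_of_notMem (by exact hx)]; simp
    _ = ENNReal.ofReal ((1 / 4) ^ J) * ν univ + ∑ k ∈ Finset.range J,
          ENNReal.ofReal ((1 / 4) ^ k) * ν (bad k) := by
        rw [lintegral_add_left measurable_const, lintegral_const, lintegral_finsetSum _
          (fun k _ => (measurable_one.indicator (hbadm k)).const_mul _)]
        congr 1
        refine Finset.sum_congr rfl fun k _ => ?_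
        rw [lintegral_const_mul _ (measurable_one.indicator (hbadm k)),
          lintegral_indicator_one (hbadm k)]
    _ ≤ ENNReal.ofReal ((1 / 4) ^ J) * ENNReal.ofReal (8 ^ J * κ) + ∑ k ∈ Finset.range J,
          ENNReal.ofReal ((1 / 4) ^ k) * ENNReal.ofReal (3 * 2 ^ (k + 1) * (4 ^ (k + 1) * κ)) := by
        gcongr with k
        exact hbadν k
    _ = ENNReal.ofReal ((1 / 4) ^ J * (8 ^ J * κ) + ∑ k ∈ Finset.range J,
          (1 / 4) ^ k * (3 * 2 ^ (k + 1) * (4 ^ (k + 1) * κ))) := by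
        rw [ENNReal.ofReal_add (by positivity) (by positivity),
          ENNReal.ofReal_sum_of_nonneg (fun k _ => by positivity),
          ENNReal.ofReal_mul (p := (1 / 4) ^ J) (by positivity)]
        congr 1
        exact Finset.sum_congr rfl fun k _ => (ENNReal.ofReal_mul (by positivity)).symm
    _ < ENNReal.ofReal (ε ^ 2) := by
        rw [ENNReal.ofReal_lt_ofReal_iff (by positivity)]
        have h1 : ((1 : ℝ) / 4) ^ J * (8 ^ J * κ) = 2 ^ J * κ := by
          rw [← mul_assoc, ← mul_pow]; norm_num
        have h2 : ∀ k : ℕ, ((1 : ℝ) / 4) ^ k * (3 * 2 ^ (k + 1) * (4 ^ (k + 1) * κ))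
            = 24 * κ * 2 ^ k := by
          intro k
          have : ((1 : ℝ) / 4) ^ k * 4 ^ k = 1 := by rw [← mul_pow]; norm_num
          rw [pow_succ, pow_succ]
          linear_combination 24 * κ * 2 ^ k * this
        have h3 : ∑ k ∈ Finset.range J, (2 : ℝ) ^ k = 2 ^ J - 1 := by
          rw [geom_sum_eq (by norm_num)]; norm_num
        rw [h1, Finset.sum_congr rfl fun k _ => h2 k, ← Finset.mul_sum, h3]
        nlinarith

/-! ### The mass of slabs -/

/-- Rotating `v` to the first coordinate axis puts the part of the ball in a slab orthogonal to `v`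
into a box. -/
lemma volume_closedBall_inter_slab_le {d : ℕ} (hd : 1 ≤ d) {v : EuclideanSpace ℝ (Fin d)}
    (hv : ‖v‖ = 1) {R : ℝ} (hR : 0 ≤ R) {a b : ℝ} :
    volume (Metric.closedBall 0 R ∩ {x : EuclideanSpace ℝ (Fin d) | inner ℝ v x ∈ Icc a b}) ≤
      ENNReal.ofReal ((2 * R) ^ (d - 1) * (b - a)) := by
  obtain ⟨n, rfl⟩ : ∃ n, d = n + 1 := ⟨d - 1, by omega⟩
  have ho : Orthonormal ℝ (({0} : Set (Fin (n + 1))).domRestrict fun _ => v) := by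
    refine ⟨fun i => hv, fun i j hij => (hij ?_).elim⟩
    exact Subsingleton.elim _ _
  obtain ⟨e, he⟩ := ho.exists_orthonormalBasis_extension_of_card_eq (by simp)
  have he0 : e 0 = v := he 0 rfl
  set box : Fin (n + 1) → Set ℝ := Fin.cons (Icc a b) fun _ => Icc (-R) R with hbox
  have hmp := (PiLp.volume_preserving_ofLp (Fin (n + 1))).comp e.measurePreserving_repr
  have hmeas : MeasurableSet (univ.pi box) := by
    refine MeasurableSet.univ_pi fun i => ?_
    refine Fin.cases ?_ (fun i => ?_) i
    · exact measurableSet_Icc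
    · exact measurableSet_Icc
  calc _ ≤ volume ((WithLp.ofLp ∘ e.repr) ⁻¹' (univ.pi box)) := by
        refine measure_mono fun x hx i _ => ?_
        have hx1 : ‖x‖ ≤ R := by simpa using hx.1
        refine Fin.cases ?_ (fun i => ?_) i
        · simp only [hbox, Fin.cons_zero, Function.comp_apply, e.repr_apply_apply, he0]
          exact hx.2
        · simp only [hbox, Fin.cons_succ, Function.comp_apply, e.repr_apply_apply]
          have := abs_real_inner_le_norm (e i.succ) x
          rw [e.orthonormal.1, one_mul] at this
          exact abs_le.1 (this.trans hx1)
    _ = volume (univ.pi box) := hmp.measure_preimage hmeas.nullMeasurableSet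
    _ = ENNReal.ofReal ((2 * R) ^ n * (b - a)) := by
        rw [volume_pi_pi, Fin.prod_univ_succ]
        simp only [hbox, Fin.cons_zero, Fin.cons_succ, Real.volume_Icc, Finset.prod_const,
          Finset.card_univ, Fintype.card_fin]
        rw [mul_comm, ENNReal.ofReal_mul (by positivity), ENNReal.ofReal_pow (by positivity)]
        ring_nf
    _ ≤ _ := by simp

lemma withDensity_apply_le_of_ae_le {E : Type*} [MeasurableSpace E] {m : Measure E} [SFinite m]
    {p : E → ℝ≥0∞} {C : ℝ≥0∞} (hp : ∀ᵐ x ∂m, p x ≤ C) (s : Set E) :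
    m.withDensity p s ≤ C * m s := by
  rw [withDensity_apply' _ s, ← setLIntegral_const]
  exact lintegral_mono_ae (ae_restrict_of_ae hp)

/-! ### Bracketing numbers and keys -/

/-- If the brackets `[l s, u s]` contain every `f s'` with the same key as `s`, then one bracket per
key suffices. -/
lemma bracketingNumber_le_card {Ω S Γ : Type*} [MeasurableSpace Ω] [Fintype Γ] {μ : Measure Ω}
    {ε : ℝ} {T : Set (Ω → ℝ)} (key : S → Γ) (f l u : S → Ω → ℝ) (hT : ∀ g ∈ T, ∃ s, f s = g)
    (hb : ∀ s, IsL2Bracket μ ε (l s) (u s))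
    (hk : ∀ s s', key s = key s' → ∀ x, l s x ≤ f s' x ∧ f s' x ≤ u s x) :
    bracketingNumber μ ε T ≤ (Fintype.card Γ : ℕ∞) := by
  classical
  set B : Finset ((Ω → ℝ) × (Ω → ℝ)) :=
    Finset.univ.image fun γ : range key => (l γ.2.choose, u γ.2.choose) with hB
  have hcard : (B.card : ℕ∞) ≤ Fintype.card Γ := by
    exact_mod_cast Finset.card_image_le.trans (Fintype.card_subtype_le _)
  refine le_trans (sInf_le ⟨B, ?_, ?_, rfl⟩) hcard
  · intro b hbB
    obtain ⟨γ, -, rfl⟩ := Finset.mem_image.1 hbB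
    exact hb _
  · intro g hg
    obtain ⟨s, rfl⟩ := hT g hg
    let γ : range key := ⟨key s, s, rfl⟩
    exact ⟨_, Finset.mem_image_of_mem _ (Finset.mem_univ γ), hk _ s γ.2.choose_spec⟩

lemma ne_top_and_log_toNat_le {n : ℕ∞} {m : ℕ} {b : ℝ} (h : n ≤ m) (hm : Real.log m ≤ b)
    (hb : 0 ≤ b) : n ≠ ⊤ ∧ Real.log (n.toNat : ℝ) ≤ b := by
  lift n to ℕ using ne_top_of_le_ne_top (ENat.natCast_ne_top m) h
  refine ⟨ENat.natCast_ne_top n, ?_⟩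
  rw [ENat.toNat_natCast]
  rcases Nat.eq_zero_or_pos n with rfl | hn
  · simpa using hb
  · exact (Real.log_le_log (by exact_mod_cast hn) (by exact_mod_cast h)).trans hm

/-! ### Sampling a link function and discretizing a direction -/

/-- The values of `h` at the points of step `w` starting from `-2R`, frozen beyond `2R`. -/
noncomputable def gridSample (h : ℝ → ℝ) (R w : ℝ) (q : ℕ) : ℝ :=
  h (min (2 * R) (-(2 * R) + q * w))

/-- The index of the cell of width `w`, counted from `-2R`, that contains `αᵀx`. -/
noncomputable def cellIndex {d : ℕ} (α : EuclideanSpace ℝ (Fin d)) (R w : ℝ)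
    (x : EuclideanSpace ℝ (Fin d)) : ℕ := ⌊(inner ℝ α x + 2 * R) / w⌋₊

/-- The coordinates of a unit vector rounded down to multiples of `1 / r`, stored as the integer
numerators shifted by `r` to make them non-negative. -/
noncomputable def directionKey {d : ℕ} (r : ℕ) (α : EuclideanSpace ℝ (Fin d)) :
    Fin d → Fin (2 * r + 1) := fun i => Fin.ofNat (2 * r + 1) (⌊α i * r⌋ + r).toNat

lemma gridSample_arg_mem {R w : ℝ} (hR : 0 < R) (hw : 0 < w) (q : ℕ) :
    min (2 * R) (-(2 * R) + q * w) ∈ Icc (-(2 * R)) (2 * R) := by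
  have : 0 ≤ (q : ℝ) * w := by positivity
  exact ⟨le_min (by linarith) (by linarith), min_le_left _ _⟩

lemma gridSample_antitone {h : ℝ → ℝ} {R w : ℝ} (hh : h ∈ monotoneClass R) (hR : 0 < R)
    (hw : 0 < w) : Antitone (gridSample h R w) := fun a b hab => by
  refine hh.1 (gridSample_arg_mem hR hw a) (gridSample_arg_mem hR hw b) ?_
  have : (a : ℝ) ≤ b := by exact_mod_cast hab
  gcongr

lemma gridSample_mem {h : ℝ → ℝ} {R w : ℝ} (hh : h ∈ monotoneClass R) (hR : 0 < R)
    (hw : 0 < w) (q : ℕ) : gridSample h R w q ∈ Icc (0 : ℝ) 1 :=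
  hh.2 (gridSample_arg_mem hR hw q)

/-- Moving the argument by at most one cell leaves `h` between the samples one cell to the left and
two cells to the right. -/
lemma gridSample_sandwich {h : ℝ → ℝ} {R w : ℝ} (hh : h ∈ monotoneClass R) (hR : 0 < R)
    (hw : 0 < w) {s t : ℝ} (hs : |s| ≤ R) (ht : |t| ≤ R) (hst : |s - t| ≤ w) :
    gridSample h R w (⌊(t + 2 * R) / w⌋₊ + 2) ≤ h s ∧
      h s ≤ gridSample h R w (⌊(t + 2 * R) / w⌋₊ - 1) := by
  obtain ⟨hs1, hs2⟩ := abs_le.1 hs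
  obtain ⟨ht1, ht2⟩ := abs_le.1 ht
  obtain ⟨hst1, hst2⟩ := abs_le.1 hst
  have hsm : s ∈ Icc (-(2 * R)) (2 * R) := ⟨by linarith, by linarith⟩
  set Q := ⌊(t + 2 * R) / w⌋₊ with hQ
  have hQ1 : (Q : ℝ) * w ≤ t + 2 * R := by
    rw [← le_div_iff₀ hw]
    exact Nat.floor_le (div_nonneg (by linarith) hw.le)
  have hQ2 : t + 2 * R < (Q + 1) * w := by
    rw [← div_lt_iff₀ hw]
    exact Nat.lt_floor_add_one _
  constructor
  · refine hh.1 hsm (gridSample_arg_mem hR hw _) (le_min hsm.2 ?_)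
    push_cast
    linarith
  · refine hh.1 (gridSample_arg_mem hR hw _) hsm ((min_le_right _ _).trans ?_)
    rcases Nat.eq_zero_or_pos Q with h0 | h0
    · rw [h0]
      push_cast
      linarith
    · rw [Nat.cast_sub h0]
      push_cast
      linarith

lemma norm_sub_le_of_directionKey_eq {d r : ℕ} (hr : 0 < r) {α β : EuclideanSpace ℝ (Fin d)}
    (hα : ‖α‖ = 1) (hβ : ‖β‖ = 1) (h : directionKey r α = directionKey r β) :
    ‖α - β‖ ≤ d / r := by
  have hr' : (0 : ℝ) < r := by exact_mod_cast hr
  have hrange : ∀ γ : EuclideanSpace ℝ (Fin d), ‖γ‖ = 1 → ∀ i,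
      0 ≤ ⌊γ i * r⌋ + (r : ℤ) ∧ ⌊γ i * r⌋ ≤ (r : ℤ) := by
    intro γ hγ i
    have h1 : |γ i| ≤ 1 := by
      have := PiLp.norm_apply_le γ i
      rwa [hγ, Real.norm_eq_abs] at this
    obtain ⟨h2, h3⟩ := abs_le.1 h1
    constructor
    · have : -(r : ℤ) ≤ ⌊γ i * r⌋ := Int.le_floor.2 (by push_cast; nlinarith)
      linarith
    · have : (⌊γ i * r⌋ : ℝ) ≤ r := (Int.floor_le _).trans (by nlinarith)
      exact_mod_cast this
  have hcoord : ∀ i, |(α - β) i| ≤ 1 / r := by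
    intro i
    have hi := congrArg Fin.val (congrFun h i)
    simp only [directionKey, Fin.val_ofNat] at hi
    obtain ⟨a1, a2⟩ := hrange α hα i
    obtain ⟨b1, b2⟩ := hrange β hβ i
    rw [Nat.mod_eq_of_lt (by omega), Nat.mod_eq_of_lt (by omega)] at hi
    have hfl : ⌊α i * r⌋ = ⌊β i * r⌋ := by omega
    have := (Int.abs_sub_lt_one_of_floor_eq_floor hfl).le
    rw [← sub_mul, abs_mul, abs_of_pos hr'] at this
    rwa [le_div_iff₀ hr']
  refine le_of_sq_le_sq ?_ (by positivity)
  rw [EuclideanSpace.norm_sq_eq]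
  calc ∑ i, ‖(α - β) i‖ ^ 2 ≤ ∑ _i : Fin d, (1 / (r : ℝ)) ^ 2 :=
        Finset.sum_le_sum fun i _ => pow_le_pow_left₀ (norm_nonneg _) (hcoord i) 2
    _ = d * (1 / (r : ℝ)) ^ 2 := by simp
    _ ≤ d ^ 2 * (1 / (r : ℝ)) ^ 2 := by
        gcongr
        exact_mod_cast Nat.le_self_pow two_ne_zero d
    _ = (d / r) ^ 2 := by ring

/-! ### The bracketing number of the single index class -/

lemma measurable_cellIndex {d : ℕ} (α : EuclideanSpace ℝ (Fin d)) (R w : ℝ) :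
    Measurable (cellIndex α R w) :=
  Nat.measurable_floor.comp (((measurable_const.inner measurable_id).add_const _).div_const _)

lemma cellIndex_lt {d : ℕ} {α x : EuclideanSpace ℝ (Fin d)} {R : ℝ} (hR : 0 < R)
    (h : |inner ℝ α x| ≤ R) (J : ℕ) : cellIndex α R (4 * R / 8 ^ J) x < 8 ^ J := by
  obtain ⟨h1, h2⟩ := abs_le.1 h
  rw [cellIndex, Nat.floor_lt (div_nonneg (by linarith) (by positivity))]
  rw [div_lt_iff₀ (by positivity)]
  push_cast
  rw [mul_div_cancel₀ _ (by positivity)]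
  linarith

lemma abs_inner_le_of_mem {d : ℕ} {α x : EuclideanSpace ℝ (Fin d)} {R : ℝ} (hα : ‖α‖ = 1)
    (hx : x ∈ Metric.closedBall 0 R) : |inner ℝ α x| ≤ R := by
  have := abs_real_inner_le_norm α x
  rw [hα, one_mul] at this
  exact this.trans (by simpa using hx)

/-- The envelopes of a sampled link function form an `ε`-bracket. The samples are taken with step
`4 * R / 8 ^ J`, so that the cells of the coarsest level `J` divide `[-2R, 2R]` into `2 ^ J` parts. -/
lemma isL2Bracket_envelope {d : ℕ} (hd : 1 ≤ d) {R D : ℝ} (hR : 0 < R) (hD : 0 < D)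
    {X : Set (EuclideanSpace ℝ (Fin d))} (hX : X ⊆ Metric.closedBall 0 R)
    {μ : Measure (EuclideanSpace ℝ (Fin d))} [IsProbabilityMeasure μ]
    (hμ : ∀ s, μ s ≤ ENNReal.ofReal D * volume s) (hB : 1 ≤ D * (2 * R) ^ d)
    {α : EuclideanSpace ℝ (Fin d)} (hα : ‖α‖ = 1) {h : ℝ → ℝ} (hh : h ∈ monotoneClass R)
    {ε : ℝ} (hε : 0 < ε) {J : ℕ} (hJ : 50 * (D * (2 * R) ^ d) < ε ^ 2 * 4 ^ J) :
    IsL2Bracket (μ.comap (Subtype.val : X → EuclideanSpace ℝ (Fin d))) ε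
      (fun x => lowerEnvelope (quantize (gridSample h R (4 * R / 8 ^ J))) J
        (cellIndex α R (4 * R / 8 ^ J) x))
      (fun x => upperEnvelope (quantize (gridSample h R (4 * R / 8 ^ J))) J
        (cellIndex α R (4 * R / 8 ^ J) x)) := by
  set w : ℝ := 4 * R / 8 ^ J with hw
  have hw0 : 0 < w := by positivity
  set F := gridSample h R w with hF
  have hFa : Antitone F := gridSample_antitone hh hR hw0
  have hF0 : ∀ q, 0 ≤ F q := fun q => (gridSample_mem hh hR hw0 q).1
  have hF1 : ∀ q, F q ≤ 1 := fun q => (gridSample_mem hh hR hw0 q).2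
  have hle : ∀ k Q, lowerEnvelope (quantize F) k Q ≤ upperEnvelope (quantize F) k Q := fun k Q =>
    (lowerEnvelope_le hFa hF0 k Q).trans ((hFa (by omega)).trans (le_upperEnvelope hFa hF1 k Q))
  set ν := μ.comap (Subtype.val : X → EuclideanSpace ℝ (Fin d)) with hν
  have hQ : Measurable fun x : X => cellIndex α R w x :=
    (measurable_cellIndex α R w).comp measurable_subtype_coe
  have hmemLp : ∀ φ : ℕ → ℝ, (∀ q, φ q ∈ Icc (0 : ℝ) 1) →
      MemLp (fun x : X => φ (cellIndex α R w x)) 2 ν := by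
    intro φ hφ
    refine MemLp.of_bound ((Measurable.of_discrete (f := φ)).comp hQ).aestronglyMeasurable 1
      (Filter.Eventually.of_forall fun x => ?_)
    rw [Real.norm_eq_abs, abs_of_nonneg (hφ _).1]
    exact (hφ _).2
  obtain ⟨n, rfl⟩ : ∃ n, d = n + 1 := ⟨d - 1, by omega⟩
  set κ : ℝ := D * (2 * R) ^ n * w with hκ
  have hκB : 8 ^ J * κ = 2 * (D * (2 * R) ^ (n + 1)) := by
    rw [hκ, hw, pow_succ]
    field_simp
    ring
  refine ⟨hmemLp _ fun q =>
      ⟨lowerEnvelope_nonneg _ _ _, (hle _ _).trans (upperEnvelope_le_one _ _ _)⟩,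
    hmemLp _ fun q => ⟨(lowerEnvelope_nonneg _ _ _).trans (hle _ _), upperEnvelope_le_one _ _ _⟩,
    fun x => hle _ _, ?_⟩
  refine eLpNorm_envelope_gap_lt hQ
    (fun x => cellIndex_lt hR (abs_inner_le_of_mem hα (hX x.2)) J)
    (quantize_antitone hFa) (fun k => quantize_le hF1 k 0) hle (κ := κ) (by positivity) ?_ ?_ hε ?_
  · intro k q
    have hmeas : MeasurableSet {x : X | cellIndex α R w x / 4 ^ k = q} :=
      hQ (MeasurableSet.of_discrete (s := {j : ℕ | j / 4 ^ k = q}))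
    refine (Measure.comap_apply_le _ _ hmeas.nullMeasurableSet).trans ((hμ _).trans ?_)
    have hsub : Subtype.val '' {x : X | cellIndex α R w x / 4 ^ k = q} ⊆
        Metric.closedBall 0 R ∩ {x | inner ℝ α x ∈
          Icc (q * (4 ^ k * w) - 2 * R) ((q + 1) * (4 ^ k * w) - 2 * R)} := by
      rintro _ ⟨x, hx, rfl⟩
      refine ⟨hX x.2, ?_⟩
      obtain ⟨h1, -⟩ := abs_le.1 (abs_inner_le_of_mem hα (hX x.2))
      have hx' : cellIndex α R w x / 4 ^ k = q := hx
      have h4 : 0 < 4 ^ k := by positivity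
      have ha : q * 4 ^ k ≤ cellIndex α R w x := (Nat.le_div_iff_mul_le h4).1 hx'.ge
      have hb : cellIndex α R w x + 1 ≤ (q + 1) * 4 ^ k :=
        (Nat.div_lt_iff_lt_mul h4).1 (by omega)
      have ha' : (q : ℝ) * 4 ^ k ≤ cellIndex α R w x := by exact_mod_cast ha
      have hb' : (cellIndex α R w x : ℝ) + 1 ≤ (q + 1) * 4 ^ k := by exact_mod_cast hb
      have hc : (cellIndex α R w x : ℝ) ≤ (inner ℝ α (x : EuclideanSpace ℝ _) + 2 * R) / w :=
        Nat.floor_le (div_nonneg (by linarith) hw0.le)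
      have hc' : (inner ℝ α (x : EuclideanSpace ℝ _) + 2 * R) / w < cellIndex α R w x + 1 :=
        Nat.lt_floor_add_one _
      rw [le_div_iff₀ hw0] at hc
      rw [div_lt_iff₀ hw0] at hc'
      have := mul_le_mul_of_nonneg_right ha' hw0.le
      have := mul_le_mul_of_nonneg_right hb' hw0.le
      constructor <;> linarith
    calc _ ≤ ENNReal.ofReal D * ENNReal.ofReal ((2 * R) ^ n * (4 ^ k * w)) := by
          gcongr
          refine (measure_mono hsub).trans ((volume_closedBall_inter_slab_le hd hα hR.le).trans ?_)
          apply ENNReal.ofReal_le_ofReal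
          apply le_of_eq
          rw [Nat.add_sub_cancel]
          ring
      _ = _ := by
          rw [← ENNReal.ofReal_mul hD.le, hκ]
          ring_nf
  · refine (Measure.comap_apply_le _ _ nullMeasurableSet_univ).trans (prob_le_one.trans ?_)
    rw [ENNReal.one_le_ofReal, hκB]
    linarith
  · -- Since `8 ^ J * κ = 2 * D * (2 * R) ^ d`, this is `hJ` divided by `4 ^ J`.
    have h8 : (8 : ℝ) ^ J = 2 ^ J * 4 ^ J := by rw [← mul_pow]; norm_num
    rw [h8] at hκB
    have h4 : (0 : ℝ) < 4 ^ J := by positivity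
    refine lt_of_mul_lt_mul_right ?_ h4.le
    linarith

/-- The bound in terms of the finest level `J`: the first factor counts directions, the second one
quantized link functions. -/
lemma bracketingNumber_singleIndexClass_le {d : ℕ} (hd : 1 ≤ d) {R D : ℝ} (hR : 0 < R)
    (hD : 0 < D) {X : Set (EuclideanSpace ℝ (Fin d))} (hX : X ⊆ Metric.closedBall 0 R)
    {μ : Measure (EuclideanSpace ℝ (Fin d))} [IsProbabilityMeasure μ]
    (hμ : ∀ s, μ s ≤ ENNReal.ofReal D * volume s) (hB : 1 ≤ D * (2 * R) ^ d)
    {ε : ℝ} (hε : 0 < ε) {J : ℕ} (hJ : 50 * (D * (2 * R) ^ d) < ε ^ 2 * 4 ^ J) :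
    bracketingNumber (μ.comap (Subtype.val : X → EuclideanSpace ℝ (Fin d))) ε
      (singleIndexClass X R) ≤ (((2 * (d * 8 ^ J) + 1) ^ d * Fintype.card ((k : Fin J) →
        Sym (Fin (2 ^ ((k : ℕ) + 1) + 1)) (8 ^ J / 4 ^ ((k : ℕ) + 1) + 3)) : ℕ) : ℕ∞) := by
  set w : ℝ := 4 * R / 8 ^ J with hw
  have hw0 : 0 < w := by positivity
  let S := {s : EuclideanSpace ℝ (Fin d) × (ℝ → ℝ) // ‖s.1‖ = 1 ∧ s.2 ∈ monotoneClass R}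
  let c : S → ℕ → ℕ → ℕ := fun s => quantize (gridSample s.1.2 R w)
  let key : S → (Fin d → Fin (2 * (d * 8 ^ J) + 1)) × ((k : Fin J) →
      Sym (Fin (2 ^ ((k : ℕ) + 1) + 1)) (8 ^ J / 4 ^ ((k : ℕ) + 1) + 3)) := fun s =>
    (directionKey (d * 8 ^ J) s.1.1, fun k => valueMultiset _ _ (c s (k + 1)))
  refine (bracketingNumber_le_card key
    (fun s (x : X) => s.1.2 (inner ℝ s.1.1 (x : EuclideanSpace ℝ (Fin d))))
    (fun s x => lowerEnvelope (c s) J (cellIndex s.1.1 R w x))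
    (fun s x => upperEnvelope (c s) J (cellIndex s.1.1 R w x)) ?_ ?_ ?_).trans ?_
  · rintro g ⟨α, hα, h, hh, hg⟩
    exact ⟨⟨(α, h), by simpa using hα, hh⟩, (funext hg).symm⟩
  · rintro ⟨⟨α, h⟩, hα, hh⟩
    exact isL2Bracket_envelope hd hR hD hX hμ hB hα hh hε hJ
  · rintro ⟨⟨α, h⟩, hα, hh⟩ ⟨⟨α', h'⟩, hα', hh'⟩ hkey x
    have hs := abs_inner_le_of_mem hα (hX x.2)
    have hs' := abs_inner_le_of_mem hα' (hX x.2)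
    have hdir : ‖α' - α‖ ≤ 1 / 8 ^ J := by
      have := norm_sub_le_of_directionKey_eq (by positivity) hα' hα (congrArg Prod.fst hkey).symm
      have hd' : (d : ℝ) ≠ 0 := by positivity
      push_cast at this
      rwa [div_mul_eq_div_div, div_self hd'] at this
    have hst : |inner ℝ α' (x : EuclideanSpace ℝ (Fin d)) -
        inner ℝ α (x : EuclideanSpace ℝ (Fin d))| ≤ w := by
      rw [← inner_sub_left]
      refine (abs_real_inner_le_norm _ _).trans ?_
      have hx : ‖(x : EuclideanSpace ℝ (Fin d))‖ ≤ R := by simpa using hX x.2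
      calc _ ≤ 1 / 8 ^ J * R := by gcongr
        _ ≤ w := by
          rw [hw, one_div_mul_eq_div]
          gcongr
          linarith
    obtain ⟨hlo, hhi⟩ := gridSample_sandwich hh' hR hw0 hs' hs hst
    have hFa := gridSample_antitone hh hR hw0
    have hFa' := gridSample_antitone hh' hR hw0
    have hF1 := fun q => (gridSample_mem hh hR hw0 q).2
    have hF1' := fun q => (gridSample_mem hh' hR hw0 q).2
    have hcongr := envelope_congr (c := quantize (gridSample h R w))
      (c' := quantize (gridSample h' R w)) (k := J) (Q := cellIndex α R w x) (by
        intro k hk q hq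
        have hlt : cellIndex α R w x / 4 ^ (k + 1) ≤ 8 ^ J / 4 ^ (k + 1) :=
          Nat.div_le_div_right (cellIndex_lt hR hs J).le
        have hqN : q < 8 ^ J / 4 ^ (k + 1) + 3 := by omega
        exact eq_of_valueMultiset_eq (quantize_antitone hFa _) (quantize_antitone hFa' _)
          (quantize_le hF1 _) (quantize_le hF1' _)
          (congrFun (congrArg Prod.snd hkey) ⟨k, hk⟩) hqN)
    simp only [c]
    rw [hcongr.1, hcongr.2]
    exact ⟨(lowerEnvelope_le hFa' (fun q => (gridSample_mem hh' hR hw0 q).1) _ _).trans hlo,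
      hhi.trans (le_upperEnvelope hFa' hF1' _ _)⟩
  · rw [Fintype.card_prod, Fintype.card_fun, Fintype.card_fin, Fintype.card_fin]

lemma log_card_le {d : ℕ} (hd : 1 ≤ d) (J : ℕ) :
    Real.log (((2 * (d * 8 ^ J) + 1) ^ d * Fintype.card ((k : Fin J) →
        Sym (Fin (2 ^ ((k : ℕ) + 1) + 1)) (8 ^ J / 4 ^ ((k : ℕ) + 1) + 3)) : ℕ) : ℝ) ≤
      21 * (d * (d : ℝ) ^ ((1 : ℝ) / 4)) * 2 ^ J := by
  have hd' : (1 : ℝ) ≤ d := by exact_mod_cast hd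
  have hcard := card_levels_le_exp J
  set N := Fintype.card ((k : Fin J) →
    Sym (Fin (2 ^ ((k : ℕ) + 1) + 1)) (8 ^ J / 4 ^ ((k : ℕ) + 1) + 3)) with hN
  have hN0 : (0 : ℝ) < N := by exact_mod_cast Fintype.card_pos
  have hlogN : Real.log N ≤ 12 * 2 ^ J := (Real.log_le_iff_le_exp hN0).2 hcard
  set e : ℝ := (d : ℝ) ^ ((1 : ℝ) / 4) with he
  have he1 : 1 ≤ e := Real.one_le_rpow hd' (by norm_num)
  have h2J : (1 : ℝ) ≤ 2 ^ J := one_le_pow₀ (by norm_num)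
  have hlogd : Real.log d ≤ 4 * e := by
    have h1 : Real.log e = 1 / 4 * Real.log d := Real.log_rpow (by linarith) _
    have h2 := Real.log_le_sub_one_of_pos (show 0 < e by linarith)
    linarith
  have hlog8 : Real.log 8 ≤ 3 := by
    rw [show (8 : ℝ) = 2 ^ 3 by norm_num, Real.log_pow]
    have := Real.log_two_lt_d9
    norm_num
    linarith
  have hlog3 : Real.log 3 ≤ 2 := by
    have := Real.log_le_sub_one_of_pos (show (0 : ℝ) < 3 by norm_num)
    linarith
  have hJ2 : (J : ℝ) ≤ 2 ^ J := by exact_mod_cast Nat.lt_two_pow_self.le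
  have h8J : (1 : ℝ) ≤ 8 ^ J := one_le_pow₀ (by norm_num)
  have hr : Real.log (2 * (d * 8 ^ J) + 1) ≤ 9 * e * 2 ^ J := by
    calc Real.log (2 * (d * 8 ^ J) + 1) ≤ Real.log (3 * (d * 8 ^ J)) :=
          Real.log_le_log (by positivity) (by nlinarith)
      _ = Real.log 3 + (Real.log d + J * Real.log 8) := by
          rw [Real.log_mul (by norm_num) (by positivity), Real.log_mul (by positivity)
            (by positivity), Real.log_pow]
      _ ≤ 2 + (4 * e + 2 ^ J * 3) := by gcongr
      _ ≤ 9 * e * 2 ^ J := by nlinarith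
  push_cast
  rw [Real.log_mul (by positivity) hN0.ne', Real.log_pow]
  have h1 : (d : ℝ) * Real.log (2 * (d * 8 ^ J) + 1) ≤ d * (9 * e * 2 ^ J) := by gcongr
  have h2 : (2 : ℝ) ^ J ≤ d * e * 2 ^ J :=
    le_mul_of_one_le_left (by positivity) (one_le_mul_of_one_le_of_one_le hd' he1)
  linarith

/-- For `ε > 1` the single bracket `[0, 1]` covers the class. -/
lemma bracketingNumber_singleIndexClass_le_one {d : ℕ} {R : ℝ} (hR : 0 < R)
    {X : Set (EuclideanSpace ℝ (Fin d))} (hX : X ⊆ Metric.closedBall 0 R)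
    {μ : Measure (EuclideanSpace ℝ (Fin d))} [IsProbabilityMeasure μ] {ε : ℝ} (hε : 1 < ε) :
    bracketingNumber (μ.comap (Subtype.val : X → EuclideanSpace ℝ (Fin d))) ε
      (singleIndexClass X R) ≤ ((1 : ℕ) : ℕ∞) := by
  refine (bracketingNumber_le_card (S := singleIndexClass X R) (Γ := Unit) (fun _ => ())
    (fun g => g) (fun _ _ => 0) (fun _ _ => 1) (fun g hg => ⟨⟨g, hg⟩, rfl⟩) ?_ ?_).trans
      (by simp)
  · refine fun _ => ⟨memLp_const _, memLp_const _, fun _ => zero_le_one, ?_⟩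
    refine eLpNorm_two_lt_of_lintegral_sq_lt (by linarith) ?_
    simp only [sub_zero, one_pow, ENNReal.ofReal_one, lintegral_const, one_mul]
    refine ((Measure.comap_apply_le _ _ nullMeasurableSet_univ).trans prob_le_one).trans_lt ?_
    rw [ENNReal.one_lt_ofReal]
    nlinarith
  · rintro _ ⟨_, α, hα, h, hh, hg⟩ _ x
    have hs := abs_le.1 (abs_inner_le_of_mem (by simpa using hα) (hX x.2))
    have := hh.2 (show inner ℝ α (x : EuclideanSpace ℝ (Fin d)) ∈ Icc (-(2 * R)) (2 * R) from
      ⟨by linarith [hs.1], by linarith [hs.2]⟩)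
    rw [← hg x] at this
    exact this

/-- A probability measure on the ball of radius `R` with density at most `D` forces
`D * (2 * R) ^ d ≥ 1`: the ball lies in a cube of side `2 * R`. -/
lemma one_le_mul_two_mul_pow {d : ℕ} (hd : 1 ≤ d) {R D : ℝ} (hR : 0 < R) (hD : 0 < D)
    {X : Set (EuclideanSpace ℝ (Fin d))} (hX : X ⊆ Metric.closedBall 0 R)
    {μ : Measure (EuclideanSpace ℝ (Fin d))} [IsProbabilityMeasure μ] (hμX : μ Xᶜ = 0)
    (hμ : ∀ s, μ s ≤ ENNReal.ofReal D * volume s) : 1 ≤ D * (2 * R) ^ d := by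
  obtain ⟨n, rfl⟩ : ∃ n, d = n + 1 := ⟨d - 1, by omega⟩
  set v : EuclideanSpace ℝ (Fin (n + 1)) := EuclideanSpace.single 0 1
  have hv : ‖v‖ = 1 := by simp [v]
  have hsub : X ⊆ Metric.closedBall 0 R ∩ {x | inner ℝ v x ∈ Icc (-R) R} := fun x hx =>
    ⟨hX hx, abs_le.1 (abs_inner_le_of_mem hv (hX hx))⟩
  rw [← ENNReal.one_le_ofReal]
  calc (1 : ℝ≥0∞) = μ (X ∪ Xᶜ) := by rw [union_compl_self, measure_univ]
    _ ≤ μ X + μ Xᶜ := measure_union_le _ _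
    _ = μ X := by rw [hμX, add_zero]
    _ ≤ ENNReal.ofReal D * ENNReal.ofReal ((2 * R) ^ (n + 1 - 1) * (R - -R)) :=
        (hμ X).trans (mul_le_mul_right
          ((measure_mono hsub).trans (volume_closedBall_inter_slab_le hd hv hR.le)) _)
    _ = _ := by
        rw [← ENNReal.ofReal_mul hD.le, Nat.add_sub_cancel]
        ring_nf

/-- The scale `√(D (2R)^d)` of the problem is dominated by the dimension factors of the bound. -/
lemma sqrt_mul_two_mul_pow_le (d : ℕ) {R D : ℝ} (hR : 0 < R) (hD : 0 < D) :
    Real.sqrt (D * (2 * R) ^ d) ≤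
      (2 : ℝ) ^ (((d : ℝ) + 1) / 2) * R ^ (((d : ℝ) - 1) / 2) * Real.sqrt R * Real.sqrt D := by
  have h1 : Real.sqrt ((2 * R) ^ d) = (2 : ℝ) ^ ((d : ℝ) / 2) * R ^ ((d : ℝ) / 2) := by
    rw [← Real.mul_rpow (by norm_num) hR.le, Real.sqrt_eq_rpow, ← Real.rpow_natCast,
      ← Real.rpow_mul (by positivity)]
    congr 1
    ring
  have h2 : R ^ (((d : ℝ) - 1) / 2) * Real.sqrt R = R ^ ((d : ℝ) / 2) := by
    rw [Real.sqrt_eq_rpow, ← Real.rpow_add hR]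
    congr 1
    ring
  rw [Real.sqrt_mul hD.le, h1, mul_assoc ((2 : ℝ) ^ _), h2, mul_comm]
  gcongr
  · norm_num
  · linarith

theorem proposition2 :
    ∃ A K : ℝ, 0 < A ∧ 0 < K ∧
      ∀ (d : ℕ), 1 ≤ d → ∀ (R D : ℝ), 0 < R → 0 < D →
      ∀ (X : Set (EuclideanSpace ℝ (Fin d))), X ⊆ Metric.closedBall 0 R →
      ∀ (μ : Measure (EuclideanSpace ℝ (Fin d))), IsProbabilityMeasure μ → μ Xᶜ = 0 →
      ∀ (p : EuclideanSpace ℝ (Fin d) → ℝ≥0∞), AEMeasurable p volume →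
        μ = volume.withDensity p → (∀ᵐ x ∂volume, p x ≤ ENNReal.ofReal D) →
      ∀ ε : ℝ, 0 < ε →
        bracketingNumber (μ.comap (Subtype.val : X → EuclideanSpace ℝ (Fin d))) ε
            (singleIndexClass X R) ≠ ⊤ ∧
        Real.log ((bracketingNumber (μ.comap (Subtype.val : X → EuclideanSpace ℝ (Fin d))) ε
            (singleIndexClass X R)).toNat : ℝ) ≤
          (2 : ℝ) ^ (((d : ℝ) + 1) / 2) * (d : ℝ) ^ ((1 : ℝ) / 4) * R ^ (((d : ℝ) - 1) / 2)
            * (1 + Real.sqrt R) * ((d : ℝ) * Real.sqrt A + K * Real.sqrt R) * Real.sqrt D / ε := by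
  refine ⟨336 ^ 2, 1, by norm_num, one_pos, ?_⟩
  intro d hd R D hR hD X hX μ hμp hμX p hp hμ hpD ε hε
  rw [Real.sqrt_sq (by norm_num)]
  have hd' : (1 : ℝ) ≤ d := by exact_mod_cast hd
  have hdom : ∀ s, μ s ≤ ENNReal.ofReal D * volume s := by
    rw [hμ]
    exact withDensity_apply_le_of_ae_le hpD
  rcases lt_or_ge 1 ε with h1 | h1
  · exact ne_top_and_log_toNat_le (bracketingNumber_singleIndexClass_le_one hR hX h1)
      (by rw [Nat.cast_one, Real.log_one]; positivity) (by positivity)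
  have hB := one_le_mul_two_mul_pow hd hR hD hX hμX hdom
  set B := Real.sqrt (D * (2 * R) ^ d) with hBdef
  have hBsq : B ^ 2 = D * (2 * R) ^ d := Real.sq_sqrt (by linarith)
  have hB1 : 1 ≤ B := Real.one_le_sqrt.2 hB
  -- The finest level `J` is such that `8 * B / ε < 2 ^ J ≤ 16 * B / ε`.
  obtain ⟨n, hn1, hn2⟩ := exists_nat_pow_near
    (show 1 ≤ 8 * B / ε by rw [le_div_iff₀ hε]; linarith) (one_lt_two : (1 : ℝ) < 2)
  have hJ : 50 * (D * (2 * R) ^ d) < ε ^ 2 * 4 ^ (n + 1) := by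
    rw [div_lt_iff₀ hε] at hn2
    have h4 : (4 : ℝ) ^ (n + 1) = (2 ^ (n + 1)) ^ 2 := by
      rw [← pow_mul, mul_comm, pow_mul]; norm_num
    have := pow_lt_pow_left₀ hn2 (by positivity) two_ne_zero
    rw [h4, ← hBsq]
    nlinarith
  refine ne_top_and_log_toNat_le
    (bracketingNumber_singleIndexClass_le hd hR hD hX hdom hB hε hJ)
    ((log_card_le hd (n + 1)).trans ?_) (by positivity)
  have hBle := sqrt_mul_two_mul_pow_le d hR hD
  rw [← hBdef] at hBle
  set e : ℝ := (d : ℝ) ^ ((1 : ℝ) / 4)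
  set a : ℝ := (2 : ℝ) ^ (((d : ℝ) + 1) / 2)
  set b : ℝ := R ^ (((d : ℝ) - 1) / 2)
  have he : 0 ≤ e := by positivity
  calc 21 * (d * e) * 2 ^ (n + 1) ≤ 21 * (d * e) * (2 * (8 * B / ε)) := by
        rw [pow_succ']
        gcongr
    _ = 336 * (d * e) * B / ε := by ring
    _ ≤ 336 * (d * e) * (a * b * Real.sqrt R * Real.sqrt D) / ε := by gcongr
    _ = a * e * b * Real.sqrt R * (d * 336) * Real.sqrt D / ε := by ring
    _ ≤ a * e * b * (1 + Real.sqrt R) * (d * 336 + 1 * Real.sqrt R) * Real.sqrt D / ε := by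
        gcongr
        · linarith
        · have := Real.sqrt_nonneg R
          linarith
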